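/- Let $\mathbb{D}$ be the open unit disk and $\partial\mathbb{D}$ its boundary with normalized arc length measure. Let $H^2$ be the Hardy space, regarded via boundary values as the closed subspace of $L^2(\partial\mathbb{D})$ of all functions whose Fourier coefficients of negative index vanish. An inner function is a bounded analytic function $\alpha$ on $\mathbb{D}$ whose radial boundary values satisfy $|\alpha|=1$ a.e. on $\partial\mathbb{D}$; its model space is $K_\alpha=H^2\ominus\alpha H^2$, $P_\alpha$ denotes the orthogonal projection from $L^2(\partial\mathbb{D})$ onto $K_\alpha$, and $K_\alpha^\infty$ is the (dense) subspace of all bounded functions in $K_\alpha$. For inner functions $\alpha,\beta$ and $\varphi\in L^2(\partial\mathbb{D})$, the asymmetric truncated Toeplitz operator $A_\varphi^{\alpha,\beta}$ is the densely defined operator from $K_\alpha$ to $K_\beta$ given by $$A_\varphi^{\alpha,\beta}f=P_\beta(\varphi f),\qquad f\in K_\alpha^\infty .$$ Let $\mathscr{T}(\alpha,\beta)$ be the complex vector space of all those $A_\varphi^{\alpha,\beta}$, $\varphi\in L^2(\partial\mathbb{D})$, that are bounded, each identified with its continuous extension $K_\alpha\to K_\beta$. **Proposition.** Let $\alpha$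 and $\beta$ be inner functions such that $\dim K_\alpha=m$ and $\dim K_\beta=n$ with $0<m,n<\infty$. Then $$\dim\mathscr{T}(\alpha,\beta)=m+n-1 .$$ -/

import Mathlib

open MeasureTheory Filter Topology AddCircle

namespace ATTO

noncomputable section

/-- Normalized Lebesgue measure on the unit circle `∂𝔻`, which is parametrized by
`t ↦ e^{2πit} = AddCircle.toCircle t`, `t ∈ ℝ/ℤ`. -/
abbrev circleMeasure : Measure UnitAddCircle := haarAddCircle

/-- `L²(∂𝔻)`. -/
abbrev L2 : Type := Lp ℂ 2 circleMeasure

/-- The point of `∂𝔻` with parameter `t`, as a complex number. -/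
def circlePoint (t : UnitAddCircle) : ℂ := (toCircle t : ℂ)

/-- The radial boundary function `t ↦ lim_{r → 1⁻} α (r e^{2πit})` of a function `α` on the disk
(with an arbitrary value where the limit does not exist). -/
def boundary (α : ℂ → ℂ) (t : UnitAddCircle) : ℂ :=
  limUnder (𝓝[<] (1 : ℝ)) fun r : ℝ => α (r * circlePoint t)

/-- Inner functions: bounded analytic functions on the open unit disk whose radial boundary values
exist and are unimodular almost everywhere. Only the values of `α` on the disk matter. -/
structure IsInner (α : ℂ → ℂ) : Prop where
  analytic : DifferentiableOn ℂ α (Metric.ball 0 1)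
  bounded : ∃ C : ℝ, ∀ z ∈ Metric.ball (0 : ℂ) 1, ‖α z‖ ≤ C
  unimodular : ∀ᵐ t ∂circleMeasure, ∃ w : ℂ, ‖w‖ = 1 ∧
    Tendsto (fun r : ℝ => α (r * circlePoint t)) (𝓝[<] 1) (𝓝 w)

theorem L2.integrable (f : L2) : Integrable f circleMeasure :=
  (Lp.memLp f).integrable one_le_two

/-- The Hardy space `H²`, as a subspace of `L²(∂𝔻)`: the functions whose Fourier coefficients of
negative index vanish. Such an `f` is the boundary function of `∑_{k ≥ 0} f̂(k) z^k`. -/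
def H2 : Submodule ℂ L2 where
  carrier := {f | ∀ k : ℤ, k < 0 → fourierCoeff f k = 0}
  zero_mem' k _ := by
    rw [fourierCoeff_congr_ae (Lp.coeFn_zero ℂ 2 circleMeasure)]
    simp [fourierCoeff]
  add_mem' {f g} hf hg k hk := by
    rw [fourierCoeff_congr_ae (Lp.coeFn_add f g),
      fourierCoeff.add (L2.integrable f) (L2.integrable g), Pi.add_apply, hf k hk, hg k hk,
      add_zero]
  smul_mem' c f hf k hk := by
    rw [fourierCoeff_congr_ae (Lp.coeFn_smul c f)]
    have := fourierCoeff.const_smul (f : UnitAddCircle → ℂ) c k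
    rw [this, hf k hk, smul_zero]

theorem isClosed_H2 : IsClosed (H2 : Set L2) := by
  have h : (H2 : Set L2) = ⋂ k : ℤ, ⋂ _ : k < 0, {f : L2 | fourierBasis.repr f k = 0} := by
    ext f
    simp only [Set.mem_iInter, Set.mem_ofPred_eq, fourierBasis_repr]
    exact Iff.rfl
  rw [h]
  refine isClosed_iInter fun k => isClosed_iInter fun _ => ?_
  refine isClosed_eq ?_ continuous_const
  simp only [HilbertBasis.repr_apply_apply]
  fun_prop

/-- The subspace `αH²` of `L²(∂𝔻)`. -/
def mulH2 (α : ℂ → ℂ) : Submodule ℂ L2 where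
  carrier := {g | ∃ h ∈ H2, (g : UnitAddCircle → ℂ) =ᵐ[circleMeasure] fun t => boundary α t * h t}
  zero_mem' := ⟨0, H2.zero_mem, by
    filter_upwards [Lp.coeFn_zero ℂ 2 circleMeasure] with t _
    simp⟩
  add_mem' := by
    rintro g₁ g₂ ⟨h₁, hh₁, e₁⟩ ⟨h₂, hh₂, e₂⟩
    refine ⟨h₁ + h₂, H2.add_mem hh₁ hh₂, ?_⟩
    filter_upwards [Lp.coeFn_add g₁ g₂, Lp.coeFn_add h₁ h₂, e₁, e₂] with t a b c d
    rw [a, b, Pi.add_apply, Pi.add_apply, c, d, mul_add]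
  smul_mem' := by
    rintro c g ⟨h, hh, e⟩
    refine ⟨c • h, H2.smul_mem c hh, ?_⟩
    filter_upwards [Lp.coeFn_smul c g, Lp.coeFn_smul c h, e] with t a b d
    rw [a, b, Pi.smul_apply, Pi.smul_apply, d, smul_eq_mul, smul_eq_mul, mul_left_comm]

/-- The model space `K_α = H² ⊖ αH²`. -/
def K (α : ℂ → ℂ) : Submodule ℂ L2 := H2 ⊓ (mulH2 α)ᗮ

instance (α : ℂ → ℂ) : CompleteSpace (K α) :=
  (isClosed_H2.inter (Submodule.isClosed_orthogonal _)).completeSpace_coe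

/-- The orthogonal projection `P_α` from `L²(∂𝔻)` onto `K_α`. -/
def P (α : ℂ → ℂ) : L2 →L[ℂ] K α := (K α).orthogonalProjectionOnto

/-- The subspace `K_α^∞` of all (essentially) bounded functions in `K_α`. -/
def KInfty (α : ℂ → ℂ) : Submodule ℂ (K α) where
  carrier := {f | MemLp (f : L2) ⊤ circleMeasure}
  zero_mem' := (memLp_congr_ae (Lp.coeFn_zero ℂ 2 circleMeasure)).2 MemLp.zero
  add_mem' {f g} hf hg := (memLp_congr_ae (Lp.coeFn_add (f : L2) (g : L2))).2 (MemLp.add hf hg)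
  smul_mem' c f hf := (memLp_congr_ae (Lp.coeFn_smul c (f : L2))).2 (MemLp.const_smul hf c)

theorem memLp_mul (φ : L2) {α : ℂ → ℂ} (f : KInfty α) :
    MemLp (fun t => φ t * (f : L2) t) 2 circleMeasure :=
  MemLp.mul (p := 2) (q := ⊤) f.2 (Lp.memLp φ)

/-- The product `φf ∈ L²(∂𝔻)` of `φ ∈ L²(∂𝔻)` and `f ∈ K_α^∞`. -/
def symbolMul (φ : L2) {α : ℂ → ℂ} (f : KInfty α) : L2 := (memLp_mul φ f).toLp _

theorem coeFn_symbolMul (φ : L2) {α : ℂ → ℂ} (f : KInfty α) :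
    symbolMul φ f =ᵐ[circleMeasure] fun t => φ t * (f : L2) t :=
  (memLp_mul φ f).coeFn_toLp

theorem symbolMul_add_right (φ : L2) {α : ℂ → ℂ} (f g : KInfty α) :
    symbolMul φ (f + g) = symbolMul φ f + symbolMul φ g := by
  apply Lp.ext
  filter_upwards [coeFn_symbolMul φ (f + g), coeFn_symbolMul φ f, coeFn_symbolMul φ g,
    Lp.coeFn_add (symbolMul φ f) (symbolMul φ g), Lp.coeFn_add (f : L2) (g : L2)] with t a b c d e
  rw [a, d, Pi.add_apply, b, c, ← mul_add, ← Pi.add_apply, ← e]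
  rfl

theorem symbolMul_smul_right (φ : L2) {α : ℂ → ℂ} (c : ℂ) (f : KInfty α) :
    symbolMul φ (c • f) = c • symbolMul φ f := by
  apply Lp.ext
  filter_upwards [coeFn_symbolMul φ (c • f), coeFn_symbolMul φ f,
    Lp.coeFn_smul c (symbolMul φ f), Lp.coeFn_smul c (f : L2)] with t a b d e
  rw [a, d, Pi.smul_apply, b, smul_eq_mul, mul_left_comm, ← smul_eq_mul c, ← Pi.smul_apply, ← e]
  rfl

theorem symbolMul_add_left (φ ψ : L2) {α : ℂ → ℂ} (f : KInfty α) :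
    symbolMul (φ + ψ) f = symbolMul φ f + symbolMul ψ f := by
  apply Lp.ext
  filter_upwards [coeFn_symbolMul (φ + ψ) f, coeFn_symbolMul φ f, coeFn_symbolMul ψ f,
    Lp.coeFn_add (symbolMul φ f) (symbolMul ψ f), Lp.coeFn_add φ ψ] with t a b c d e
  rw [a, d, Pi.add_apply, b, c, ← add_mul, ← Pi.add_apply, ← e]

theorem symbolMul_smul_left (c : ℂ) (φ : L2) {α : ℂ → ℂ} (f : KInfty α) :
    symbolMul (c • φ) f = c • symbolMul φ f := by
  apply Lp.ext
  filter_upwards [coeFn_symbolMul (c • φ) f, coeFn_symbolMul φ f,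
    Lp.coeFn_smul c (symbolMul φ f), Lp.coeFn_smul c φ] with t a b d e
  rw [a, d, Pi.smul_apply, b, e, Pi.smul_apply, smul_eq_mul, smul_eq_mul, mul_assoc]

/-- The asymmetric truncated Toeplitz operator `A_φ^{α,β} f = P_β(φf)` with symbol
`φ ∈ L²(∂𝔻)`, as a densely defined operator from `K_α` to `K_β` with domain `K_α^∞`. -/
def A (α β : ℂ → ℂ) (φ : L2) : KInfty α →ₗ[ℂ] K β where
  toFun f := P β (symbolMul φ f)
  map_add' f g := by rw [symbolMul_add_right, map_add]
  map_smul' c f := by rw [symbolMul_smul_right, map_smul, RingHom.id_apply]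

theorem A_apply (α β : ℂ → ℂ) (φ : L2) (f : KInfty α) : A α β φ f = P β (symbolMul φ f) := rfl

/-- The space `𝒯(α,β)` of all bounded asymmetric truncated Toeplitz operators: the bounded operators
`B : K_α → K_β` that extend some `A_φ^{α,β}`, `φ ∈ L²(∂𝔻)`, from its dense domain `K_α^∞`
(which is all of `K_α` when `K_α` is finite-dimensional). -/
def T (α β : ℂ → ℂ) : Submodule ℂ (K α →L[ℂ] K β) where
  carrier := {B | ∃ φ : L2, ∀ f : KInfty α, B f = A α β φ f}
  zero_mem' := ⟨0, fun f => by
    have h : symbolMul 0 f = 0 := by simpa using symbolMul_smul_left 0 0 f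
    rw [A_apply, h, map_zero, ContinuousLinearMap.zero_apply]⟩
  add_mem' := by
    rintro B C ⟨φ, hφ⟩ ⟨ψ, hψ⟩
    refine ⟨φ + ψ, fun f => ?_⟩
    rw [ContinuousLinearMap.add_apply, hφ, hψ, A_apply, A_apply, A_apply, symbolMul_add_left,
      map_add]
  smul_mem' := by
    rintro c B ⟨φ, hφ⟩
    refine ⟨c • φ, fun f => ?_⟩
    rw [ContinuousLinearMap.smul_apply, hφ, A_apply, A_apply, symbolMul_smul_left, map_smul]

end

end ATTO

namespace ATTO

open scoped ComplexConjugate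

noncomputable section

/-! In suitable bases the operators become exactly the `m × n` Toeplitz matrices, which have `m + n
- 1` free diagonals. A model space is invariant under the backward shift `S`. If it has dimension
`m` and `p` is the characteristic polynomial of `S` on it, put `q(z) = z^m p(1/z)`. Cayley-Hamilton
makes `q f` a polynomial of degree less than `m` for every `f` in the space, and `q` has no zero on
the circle because eigenvalues of `S` on `H²` have modulus less than one. Hence the `z^i / q`, `i <
m`, form a basis (`exists_basis_of_backwardShift_invariant`). With the analogous basis `z^j / r` of
`K_β`, the entry `⟨z^j / r, A_φ (z^i / q)⟩` is the Fourier coefficient of `φ / (q r̄)` at `j - i`,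
and these coefficients can be prescribed freely through `φ` (`map_entries_T`). -/

/-! ### Multiplication by continuous functions and Fourier coefficients -/

theorem memLp_continuous_mul (b : C(UnitAddCircle, ℂ)) (f : L2) :
    MemLp (fun t => b t * f t) 2 circleMeasure := by
  have hb : MemLp (fun t => b t) ⊤ circleMeasure :=
    memLp_top_of_bound b.continuous.aestronglyMeasurable ‖b‖
      (Eventually.of_forall fun t => b.norm_coe_le_norm t)
  exact MemLp.mul (p := ⊤) (q := 2) (Lp.memLp f) hb

/-- Multiplication of an `L²` function by a continuous function. -/
def mulC : C(UnitAddCircle, ℂ) →ₗ[ℂ] L2 →ₗ[ℂ] L2 :=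
  LinearMap.mk₂ ℂ (fun b f => (memLp_continuous_mul b f).toLp _)
    (fun b c f => by
      rw [← MemLp.toLp_add]
      exact MemLp.toLp_congr _ _ (Eventually.of_forall fun t => by simp [add_mul]))
    (fun c b f => by
      rw [← MemLp.toLp_const_smul]
      exact MemLp.toLp_congr _ _ (Eventually.of_forall fun t => by simp [mul_assoc]))
    (fun b f g => by
      rw [← MemLp.toLp_add]
      refine MemLp.toLp_congr _ _ ?_
      filter_upwards [Lp.coeFn_add f g] with t h
      rw [h, Pi.add_apply, Pi.add_apply, mul_add])
    (fun c b f => by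
      rw [← MemLp.toLp_const_smul]
      refine MemLp.toLp_congr _ _ ?_
      filter_upwards [Lp.coeFn_smul c f] with t h
      rw [h, Pi.smul_apply, Pi.smul_apply, smul_eq_mul, smul_eq_mul, mul_left_comm])

theorem coeFn_mulC (b : C(UnitAddCircle, ℂ)) (f : L2) :
    mulC b f =ᵐ[circleMeasure] fun t => b t * f t :=
  (memLp_continuous_mul b f).coeFn_toLp

theorem mulC_injective {b : C(UnitAddCircle, ℂ)} (hb : ∀ t, b t ≠ 0) {f g : L2}
    (h : mulC b f = mulC b g) : f = g := by
  apply Lp.ext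
  have hf := coeFn_mulC b f
  rw [h] at hf
  filter_upwards [hf, coeFn_mulC b g] with t h1 h2
  exact mul_left_cancel₀ (hb t) (h1.symm.trans h2)

/-- The `k`-th Fourier coefficient as a linear functional on `L²`. -/
def coef (k : ℤ) : L2 →ₗ[ℂ] ℂ where
  toFun f := fourierCoeff f k
  map_add' f g := by
    rw [fourierCoeff_congr_ae (Lp.coeFn_add f g),
      fourierCoeff.add (L2.integrable f) (L2.integrable g), Pi.add_apply]
  map_smul' c f := by
    rw [fourierCoeff_congr_ae (Lp.coeFn_smul c f)]
    exact fourierCoeff.const_smul (f : UnitAddCircle → ℂ) c k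

theorem coef_apply (k : ℤ) (f : L2) : coef k f = fourierCoeff f k := rfl

theorem coef_eq_inner (k : ℤ) (f : L2) : coef k f = inner ℂ (fourierLp 2 k : L2) f := by
  rw [coef_apply, ← fourierBasis_repr, HilbertBasis.repr_apply_apply, coe_fourierBasis]

theorem ext_coef {f g : L2} (h : ∀ k, coef k f = coef k g) : f = g := by
  apply fourierBasis.repr.injective
  ext k
  rw [fourierBasis_repr, fourierBasis_repr]
  exact h k

theorem coef_fourierLp (k n : ℤ) : coef k (fourierLp 2 n : L2) = if k = n then 1 else 0 := by
  rw [coef_eq_inner, orthonormal_iff_ite.1 orthonormal_fourier k n]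

theorem coef_mulC_fourier (k n : ℤ) (f : L2) :
    coef k (mulC (fourier n) f) = coef (k - n) f := by
  rw [coef_apply, fourierCoeff_congr_ae (coeFn_mulC (fourier n) f), coef_apply]
  refine integral_congr_ae (Eventually.of_forall fun t => ?_)
  simp only [smul_eq_mul]
  rw [← mul_assoc, ← fourier_add]
  congr 3
  ring

theorem mem_H2 {f : L2} : f ∈ H2 ↔ ∀ k : ℤ, k < 0 → coef k f = 0 := Iff.rfl

theorem inner_mulC_fourier (n : ℤ) (f g : L2) :
    inner ℂ g (mulC (fourier (-n)) f) = inner ℂ (mulC (fourier n) g) f := by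
  rw [L2.inner_def, L2.inner_def]
  refine integral_congr_ae ?_
  filter_upwards [coeFn_mulC (fourier (-n)) f, coeFn_mulC (fourier n) g] with t h1 h2
  rw [h1, h2]
  simp only [RCLike.inner_apply, map_mul, fourier_neg]
  ring

/-! ### Boundary values of inner functions -/

/-- The radii `1 - 1 / (j + 1)`, which increase to `1`. -/
def radius (j : ℕ) : ℝ := 1 - 1 / ((j : ℝ) + 1)

theorem radius_nonneg (j : ℕ) : 0 ≤ radius j := by
  have : 1 / ((j : ℝ) + 1) ≤ 1 := by
    rw [div_le_one (by positivity)]; linarith [(Nat.cast_nonneg j : (0 : ℝ) ≤ j)]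
  unfold radius; linarith

theorem radius_lt_one (j : ℕ) : radius j < 1 := by
  have : 0 < 1 / ((j : ℝ) + 1) := by positivity
  unfold radius; linarith

theorem tendsto_radius : Tendsto radius atTop (𝓝[<] 1) := by
  refine tendsto_nhdsWithin_iff.2 ⟨?_, Eventually.of_forall radius_lt_one⟩
  have := (tendsto_one_div_add_atTop_nhds_zero_nat (𝕜 := ℝ)).const_sub 1
  rwa [sub_zero] at this

theorem continuous_circlePoint : Continuous circlePoint :=
  continuous_subtype_val.comp continuous_toCircle

theorem norm_circlePoint (t : UnitAddCircle) : ‖circlePoint t‖ = 1 := Circle.norm_coe _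

theorem mul_circlePoint_mem_ball {r : ℝ} (h0 : 0 ≤ r) (h1 : r < 1) (t : UnitAddCircle) :
    (r : ℂ) * circlePoint t ∈ Metric.ball (0 : ℂ) 1 := by
  simp [norm_circlePoint, abs_of_nonneg h0, h1]

namespace IsInner

variable {α : ℂ → ℂ} (hα : IsInner α)
include hα

/-- A sequence of radii suffices for measurability of the boundary function and for dominated
convergence. -/
theorem boundary_spec : ∀ᵐ t ∂circleMeasure, ‖boundary α t‖ = 1 ∧
    Tendsto (fun j => α (radius j * circlePoint t)) atTop (𝓝 (boundary α t)) := by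
  filter_upwards [hα.unimodular] with t ⟨w, hw, ht⟩
  have : boundary α t = w := ht.limUnder_eq
  rw [this]
  exact ⟨hw, ht.comp tendsto_radius⟩

theorem continuous_dilate (j : ℕ) : Continuous fun t => α (radius j * circlePoint t) :=
  hα.analytic.continuousOn.comp_continuous (continuous_const.mul continuous_circlePoint)
    fun t => mul_circlePoint_mem_ball (radius_nonneg j) (radius_lt_one j) t

theorem aestronglyMeasurable_boundary : AEStronglyMeasurable (boundary α) circleMeasure :=
  aestronglyMeasurable_of_tendsto_ae atTop
    (fun j => (hα.continuous_dilate j).aestronglyMeasurable)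
    (hα.boundary_spec.mono fun _ h => h.2)

/-- For `k = -(n + 1)` the coefficient is the circle average of `z^(n+1) α(rz)`, hence by the mean
value property its value at `0`. -/
theorem fourierCoeff_dilate {r : ℝ} (h0 : 0 ≤ r) (h1 : r < 1) {k : ℤ} (hk : k < 0) :
    fourierCoeff (fun t : UnitAddCircle => α (r * circlePoint t)) k = 0 := by
  obtain ⟨n, rfl⟩ : ∃ n : ℕ, k = -((n : ℤ) + 1) := ⟨(-k - 1).toNat, by omega⟩
  have hd : DiffContOnCl ℂ (fun z : ℂ => z ^ (n + 1) * α (r * z)) (Metric.ball 0 |1|) := by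
    apply DifferentiableOn.diffContOnCl
    rw [abs_one, closure_ball _ one_ne_zero]
    refine (differentiableOn_id.pow _).mul (hα.analytic.comp (by fun_prop) fun z hz => ?_)
    have hz : ‖z‖ ≤ 1 := by simpa using hz
    simp only [Metric.mem_ball, dist_zero_right, norm_mul, Complex.norm_real, Real.norm_eq_abs,
      abs_of_nonneg h0]
    nlinarith [norm_nonneg z]
  have hm := hd.circleAverage
  rw [zero_pow (Nat.succ_ne_zero n), zero_mul, Real.circleAverage] at hm
  rw [fourierCoeff_eq_intervalIntegral _ _ 0, ← hm]
  have h := intervalIntegral.smul_integral_comp_mul_left (a := 0) (b := 1)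
    (fun θ => (fun z : ℂ => z ^ (n + 1) * α (r * z)) (circleMap 0 1 θ)) (2 * Real.pi)
  rw [mul_zero, mul_one] at h
  rw [← h, smul_smul, inv_mul_cancel₀ (by positivity), one_smul]
  simp only [div_one, zero_add, one_smul]
  refine intervalIntegral.integral_congr fun x _ => ?_
  have hx : circlePoint (x : UnitAddCircle) = circleMap 0 1 (2 * Real.pi * x) := by
    simp [circlePoint, toCircle_apply_mk, circleMap]
  have hf : fourier (n + 1 : ℤ) (x : UnitAddCircle) = circlePoint x ^ (n + 1) := by
    rw [fourier_apply, toCircle_zsmul]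
    simp only [circlePoint]
    exact_mod_cast rfl
  simp only [neg_neg, smul_eq_mul]
  rw [hf, hx]

theorem fourierCoeff_boundary {k : ℤ} (hk : k < 0) : fourierCoeff (boundary α) k = 0 := by
  obtain ⟨C, hC⟩ := hα.bounded
  have ht : Tendsto (fun j => fourierCoeff (fun t => α (radius j * circlePoint t)) k) atTop
      (𝓝 (fourierCoeff (boundary α) k)) := by
    refine tendsto_integral_of_dominated_convergence (fun _ => C)
      (fun j => ?_) (integrable_const C) (fun j => ?_) ?_
    · exact ((fourier (-k)).continuous.smul (hα.continuous_dilate j)).aestronglyMeasurable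
    · refine Eventually.of_forall fun t => ?_
      rw [norm_smul, fourier_apply, Circle.norm_coe, one_mul]
      exact hC _ (mul_circlePoint_mem_ball (radius_nonneg j) (radius_lt_one j) t)
    · filter_upwards [hα.boundary_spec] with t h
      exact h.2.const_smul _
  refine tendsto_nhds_unique ht ?_
  simp only [hα.fourierCoeff_dilate (radius_nonneg _) (radius_lt_one _) hk]
  exact tendsto_const_nhds

theorem memLp_boundary_mul {f : UnitAddCircle → ℂ} (hf : MemLp f 2 circleMeasure) :
    MemLp (fun t => boundary α t * f t) 2 circleMeasure := by
  have hb : MemLp (boundary α) ⊤ circleMeasure :=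
    memLp_top_of_bound hα.aestronglyMeasurable_boundary 1
      (hα.boundary_spec.mono fun _ h => h.1.le)
  exact MemLp.mul (p := ⊤) (q := 2) hf hb

/-- By Parseval, the `k`-th coefficient of `αh` is the sum over `l` of `α̂(k - l) ĥ(l)`; if `k < 0`,
then `l < 0` or `k - l < 0`, so every term vanishes. -/
theorem mulH2_le : mulH2 α ≤ H2 := by
  rintro g ⟨h, hh, e⟩ k hk
  rw [fourierCoeff_congr_ae e]
  have hmem : MemLp (fun t => conj (boundary α t * fourier (-k) t)) 2 circleMeasure := by
    have h1 : MemLp (fun t => fourier (-k) t) 2 circleMeasure :=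
      (fourier (-k)).continuous.memLp_of_hasCompactSupport (HasCompactSupport.of_compactSpace _)
    exact (hα.memLp_boundary_mul h1).star
  set u : L2 := hmem.toLp _ with hu
  have hu' : u =ᵐ[circleMeasure] fun t => conj (boundary α t * fourier (-k) t) :=
    hmem.coeFn_toLp
  have h1 : fourierCoeff (fun t => boundary α t * h t) k = inner ℂ u h := by
    rw [L2.inner_def]
    refine integral_congr_ae ?_
    filter_upwards [hu'] with t ht
    rw [ht]
    simp only [RCLike.inner_apply, smul_eq_mul, Complex.conj_conj]
    ring
  rw [h1, ← fourierBasis.tsum_inner_mul_inner u h]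
  refine (tsum_congr fun l => ?_).trans tsum_zero
  rw [coe_fourierBasis, ← coef_eq_inner]
  rcases lt_or_ge l 0 with hl | hl
  · rw [mem_H2.1 hh l hl, mul_zero]
  · rw [← inner_conj_symm, ← coef_eq_inner, coef_apply, fourierCoeff_congr_ae hu']
    have : fourierCoeff (fun t => conj (boundary α t * fourier (-k) t)) l
        = conj (fourierCoeff (boundary α) (k - l)) := by
      rw [fourierCoeff, fourierCoeff, ← integral_conj]
      refine integral_congr_ae (Eventually.of_forall fun t => ?_)
      simp only [smul_eq_mul, map_mul]
      rw [show -(k - l) = -k + l by ring, fourier_add, map_mul, fourier_neg (n := l)]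
      ring
    rw [this, hα.fourierCoeff_boundary (by omega), map_zero, map_zero, zero_mul]

end IsInner

/-! ### The backward shift -/

/-- The backward shift on `L²`, which acts on `H²` as `f ↦ (f - f(0)) / z`. -/
def backwardShift : L2 →ₗ[ℂ] L2 :=
  mulC (fourier (-1)) - (coef 0).smulRight (fourierLp 2 (-1) : L2)

theorem backwardShift_apply (f : L2) :
    backwardShift f = mulC (fourier (-1)) f - coef 0 f • (fourierLp 2 (-1) : L2) := rfl

theorem coef_backwardShift {k : ℤ} (hk : k ≠ -1) (f : L2) :
    coef k (backwardShift f) = coef (k + 1) f := by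
  rw [backwardShift_apply, map_sub, map_smul, coef_mulC_fourier, coef_fourierLp, if_neg hk]
  simp

theorem coef_neg_one_backwardShift (f : L2) : coef (-1) (backwardShift f) = 0 := by
  rw [backwardShift_apply, map_sub, map_smul, coef_mulC_fourier, coef_fourierLp]
  simp

theorem backwardShift_mem_H2 {f : L2} (hf : f ∈ H2) : backwardShift f ∈ H2 := by
  intro k hk
  rw [← coef_apply]
  rcases eq_or_ne k (-1) with rfl | h
  · exact coef_neg_one_backwardShift f
  · rw [coef_backwardShift h]
    exact hf _ (by omega)

theorem mulC_fourier_mem_mulH2 {α : ℂ → ℂ} {g : L2} (hg : g ∈ mulH2 α) :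
    mulC (fourier 1) g ∈ mulH2 α := by
  obtain ⟨h, hh, e⟩ := hg
  refine ⟨mulC (fourier 1) h, fun k hk => ?_, ?_⟩
  · rw [← coef_apply, coef_mulC_fourier]
    exact hh _ (by omega)
  · filter_upwards [coeFn_mulC (fourier 1) g, coeFn_mulC (fourier 1) h, e] with t a b c
    rw [a, b, c, mul_left_comm]

/-- For `g ∈ αH²`, `⟨g, z̄f⟩ = ⟨zg, f⟩ = 0` because `zg ∈ αH²`, and `⟨g, z̄⟩ = 0` because `αH² ⊆
H²`. -/
theorem IsInner.backwardShift_mem_K {α : ℂ → ℂ} (hα : IsInner α) {f : L2} (hf : f ∈ K α) :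
    backwardShift f ∈ K α := by
  refine ⟨backwardShift_mem_H2 hf.1, ?_⟩
  rw [SetLike.mem_coe, Submodule.mem_orthogonal]
  intro g hg
  rw [backwardShift_apply, inner_sub_right, inner_smul_right, inner_mulC_fourier,
    (Submodule.mem_orthogonal _ _).1 hf.2 _ (mulC_fourier_mem_mulH2 hg), ← inner_conj_symm,
    ← coef_eq_inner, mem_H2.1 (hα.mulH2_le hg) _ (by norm_num)]
  simp

theorem tendsto_coef_natCast (f : L2) : Tendsto (fun k : ℕ => coef k f) atTop (𝓝 0) := by
  have h := ((hasSum_sq_fourierCoeff f).summable.comp_injective Nat.cast_injective)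
    |>.tendsto_atTop_zero
  rw [tendsto_zero_iff_norm_tendsto_zero]
  have h2 := h.sqrt
  rw [Real.sqrt_zero] at h2
  refine h2.congr fun k => ?_
  simp only [Function.comp_apply]
  rw [Real.sqrt_sq (norm_nonneg _), coef_apply]

theorem coef_backwardShift_pow (j k : ℕ) (f : L2) :
    coef k ((backwardShift ^ j) f) = coef ((k + j : ℕ) : ℤ) f := by
  induction j generalizing k with
  | zero => rfl
  | succ j ih =>
    rw [pow_succ', Module.End.mul_apply, coef_backwardShift (by omega)]
    have := ih (k + 1)
    push_cast at this ⊢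
    rw [this]
    congr 1
    ring_nf

/-- The coefficients of an eigenvector are `μ^k f̂(0)`; they tend to `0`, so `‖μ‖ ≥ 1` would force
`f̂(0) = 0` and `f = 0`. -/
theorem norm_lt_one_of_backwardShift_eq {f : L2} (hf : f ∈ H2) (h0 : f ≠ 0) {μ : ℂ}
    (h : backwardShift f = μ • f) : ‖μ‖ < 1 := by
  by_contra! hμ
  have hc : ∀ k : ℕ, coef k f = μ ^ k * coef 0 f := by
    intro k
    induction k with
    | zero => simp
    | succ k ih =>
      have := coef_backwardShift (k := k) (by omega) f
      rw [h, map_smul, ih, smul_eq_mul] at this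
      push_cast
      rw [← this, pow_succ']
      ring
  have hz : coef 0 f = 0 := by
    rw [← norm_le_zero_iff]
    refine ge_of_tendsto (tendsto_zero_iff_norm_tendsto_zero.1 (tendsto_coef_natCast f))
      (Eventually.of_forall fun k => ?_)
    rw [hc, norm_mul, norm_pow]
    exact le_mul_of_one_le_left (norm_nonneg _) (one_le_pow₀ hμ)
  refine h0 (ext_coef fun k => ?_)
  rw [map_zero]
  rcases lt_or_ge k 0 with hk | hk
  · exact hf k hk
  · lift k to ℕ using hk
    rw [hc, hz, mul_zero]

/-! ### Finite-dimensional invariant subspaces -/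

/-- The restriction to the circle of the polynomial `z ^ p.natDegree * p (1 / z)`. -/
def reversePoly (p : Polynomial ℂ) : C(UnitAddCircle, ℂ) :=
  ∑ j ∈ Finset.range (p.natDegree + 1), p.coeff j • fourier ((p.natDegree : ℤ) - j)

theorem reversePoly_apply (p : Polynomial ℂ) (t : UnitAddCircle) :
    reversePoly p t = fourier (p.natDegree : ℤ) t * p.eval (fourier (-1) t) := by
  rw [Polynomial.eval_eq_sum_range, Finset.mul_sum, reversePoly, ContinuousMap.sum_apply]
  refine Finset.sum_congr rfl fun j _ => ?_
  rw [ContinuousMap.smul_apply, smul_eq_mul, sub_eq_add_neg, fourier_add]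
  have : (fourier (-(j : ℤ)) t : ℂ) = fourier (-1) t ^ j := by
    simp only [fourier_apply, neg_smul, one_smul, toCircle_neg, toCircle_zsmul]
    simp
  rw [this]
  ring

theorem coef_mulC_reversePoly (p : Polynomial ℂ) (f : L2) (l : ℤ) :
    coef l (mulC (reversePoly p) f) =
      ∑ j ∈ Finset.range (p.natDegree + 1), p.coeff j * coef (l - p.natDegree + j) f := by
  rw [reversePoly, map_sum, LinearMap.sum_apply, map_sum]
  refine Finset.sum_congr rfl fun j _ => ?_
  rw [map_smul, LinearMap.smul_apply, map_smul, coef_mulC_fourier, smul_eq_mul]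
  congr 3
  ring

/-- A finite-dimensional backward shift invariant subspace of `H²` consists of the quotients `p / q`
with `p` a polynomial of degree less than its dimension, for a suitable polynomial `q` without
zeros on the circle. -/
theorem exists_basis_of_backwardShift_invariant {M : Submodule ℂ L2} (hM : M ≤ H2)
    [FiniteDimensional ℂ M] (hS : ∀ f ∈ M, backwardShift f ∈ M) :
    ∃ (q : C(UnitAddCircle, ℂ)) (b : Module.Basis (Fin (Module.finrank ℂ M)) ℂ M),
      (∀ t, q t ≠ 0) ∧ ∀ i, mulC q (b i) = fourierLp 2 (i : ℤ) := by
  set T : Module.End ℂ M := backwardShift.restrict hS with hT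
  set p := T.charpoly with hp
  have hdeg : p.natDegree = Module.finrank ℂ M := LinearMap.charpoly_natDegree T
  have hpow : ∀ (j : ℕ) (f : M), (((T ^ j) f : M) : L2) = (backwardShift ^ j) (f : L2) := by
    intro j f
    induction j with
    | zero => rfl
    | succ j ih => rw [pow_succ', pow_succ', Module.End.mul_apply, Module.End.mul_apply, ← ih]; rfl
  -- A zero at `z` on the circle would make `z̄` an eigenvalue of modulus one.
  have hq : ∀ t, reversePoly p t ≠ 0 := by
    intro t ht
    rw [reversePoly_apply, mul_eq_zero] at ht
    have hn : ∀ n : ℤ, ‖(fourier n t : ℂ)‖ = 1 := fun n => by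
      rw [fourier_apply, Circle.norm_coe]
    rcases ht with ht | ht
    · have := hn p.natDegree
      rw [ht, norm_zero] at this
      exact zero_ne_one this
    · obtain ⟨v, hv⟩ := ((Module.End.hasEigenvalue_iff_isRoot_charpoly T _).2 ht).exists_hasEigenvector
      have hv1 : backwardShift (v : L2) = (fourier (-1) t : ℂ) • (v : L2) :=
        congrArg Subtype.val hv.apply_eq_smul
      have := norm_lt_one_of_backwardShift_eq (hM v.2)
        (fun h => hv.2 (Subtype.ext h)) hv1
      exact this.ne (hn _)
  have hneg : ∀ (f : M) (l : ℤ), l < 0 → coef l (mulC (reversePoly p) (f : L2)) = 0 := by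
    intro f l hl
    rw [coef_mulC_reversePoly]
    refine Finset.sum_eq_zero fun j hj => ?_
    rw [Finset.mem_range] at hj
    rw [mem_H2.1 (hM f.2) _ (by omega), mul_zero]
  -- Here the coefficient of `q f` at `k + deg p` is the `k`-th coefficient of `p(S) f`, which is
  -- zero by Cayley-Hamilton.
  have hlarge : ∀ (f : M) (l : ℤ), (p.natDegree : ℤ) ≤ l →
      coef l (mulC (reversePoly p) (f : L2)) = 0 := by
    intro f l hl
    obtain ⟨k, rfl⟩ : ∃ k : ℕ, l = k + p.natDegree := ⟨(l - p.natDegree).toNat, by omega⟩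
    rw [coef_mulC_reversePoly]
    have h0 : Polynomial.aeval T p f = 0 := by
      rw [hp, LinearMap.aeval_self_charpoly, LinearMap.zero_apply]
    rw [Polynomial.aeval_eq_sum_range, LinearMap.sum_apply] at h0
    have h1 := congrArg (fun g : M => coef (k : ℤ) (g : L2)) h0
    simp only [LinearMap.smul_apply, Submodule.coe_sum, Submodule.coe_smul, map_sum, map_smul,
      hpow, coef_backwardShift_pow, Submodule.coe_zero, map_zero, smul_eq_mul] at h1
    rw [← h1]
    refine Finset.sum_congr rfl fun j _ => ?_
    congr 3
    push_cast
    ring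
  -- Only the coefficients of `q f` from `0` to `deg p - 1` survive. Since `deg p = dim M`,
  -- injectivity makes `Φ` an isomorphism, and the standard basis pulls back to the `z^i / q`.
  let Φ : M →ₗ[ℂ] (Fin (Module.finrank ℂ M) → ℂ) :=
    LinearMap.pi fun i => coef (i : ℤ) ∘ₗ mulC (reversePoly p) ∘ₗ M.subtype
  have hΦ : ∀ f i, Φ f i = coef (i : ℤ) (mulC (reversePoly p) (f : L2)) := fun _ _ => rfl
  have hinj : Function.Injective Φ := by
    intro f g hfg
    refine Subtype.ext (mulC_injective hq (ext_coef fun k => ?_))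
    rcases lt_or_ge k 0 with hk | hk
    · rw [hneg f k hk, hneg g k hk]
    · rcases lt_or_ge k p.natDegree with hk' | hk'
      · lift k to ℕ using hk
        exact congrFun hfg ⟨k, by omega⟩
      · rw [hlarge f k hk', hlarge g k hk']
  let e := LinearEquiv.ofInjectiveOfFinrankEq Φ hinj (by simp)
  refine ⟨reversePoly p, Module.Basis.ofEquivFun e, hq, fun i => ext_coef fun k => ?_⟩
  have hb : Φ (Module.Basis.ofEquivFun e i) = Pi.single i 1 := by
    rw [Module.Basis.coe_ofEquivFun]
    exact e.apply_symm_apply _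
  rw [coef_fourierLp]
  rcases lt_or_ge k 0 with hk | hk
  · rw [hneg _ k hk, if_neg (by omega)]
  · rcases lt_or_ge k p.natDegree with hk' | hk'
    · lift k to ℕ using hk
      have := congrFun hb ⟨k, by omega⟩
      rw [hΦ] at this
      simp only [Pi.single_apply, Fin.ext_iff] at this
      rw [this]
      simp
    · rw [hlarge _ k hk', if_neg (by omega)]

/-! ### Matrix entries and Toeplitz matrices -/

theorem coeFn_eq_div_of_mulC_eq {q : C(UnitAddCircle, ℂ)} (hq : ∀ t, q t ≠ 0) {f : L2} {k : ℤ}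
    (h : mulC q f = fourierLp 2 k) : f =ᵐ[circleMeasure] fun t => fourier k t / q t := by
  have h1 := coeFn_mulC q f
  rw [h] at h1
  filter_upwards [h1, coeFn_fourierLp 2 k] with t a b
  rw [eq_div_iff (hq t), mul_comm, ← a, b]

theorem memLp_top_of_mulC_eq {q : C(UnitAddCircle, ℂ)} (hq : ∀ t, q t ≠ 0) {f : L2} {k : ℤ}
    (h : mulC q f = fourierLp 2 k) : MemLp f ⊤ circleMeasure :=
  (memLp_congr_ae (coeFn_eq_div_of_mulC_eq hq h)).2 <|
    ((fourier k).continuous.div q.continuous hq).memLp_of_hasCompactSupport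
      (HasCompactSupport.of_compactSpace _)

/-- On the circle `z^i` times the conjugate of `z^j` is `z^(i-j)`, so the entry depends only on `j -
i`: this is the Toeplitz structure. -/
theorem inner_symbolMul {α : ℂ → ℂ} {q r : C(UnitAddCircle, ℂ)} (hq : ∀ t, q t ≠ 0)
    (hr : ∀ t, r t ≠ 0) (φ : L2) (f : KInfty α) {g : L2} {i j : ℤ}
    (hf : mulC q (f : L2) = fourierLp 2 i) (hg : mulC r g = fourierLp 2 j) :
    inner ℂ g (symbolMul φ f) = fourierCoeff (fun t => φ t / (q t * conj (r t))) (j - i) := by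
  rw [L2.inner_def]
  refine integral_congr_ae ?_
  filter_upwards [coeFn_symbolMul φ f, coeFn_eq_div_of_mulC_eq hq hf,
    coeFn_eq_div_of_mulC_eq hr hg] with t a b c
  rw [a, b, c]
  simp only [RCLike.inner_apply, smul_eq_mul, map_div₀]
  rw [show -(j - i) = i + -j by ring, fourier_add, fourier_neg]
  have h1 := hq t
  have h2 : conj (r t) ≠ 0 := (map_ne_zero _).2 (hr t)
  field_simp

/-- The matrix with entries `c (i - j)`, the diagonals being numbered from `0`. -/
def toeplitz (m n : ℕ) : (Fin (m + n - 1) → ℂ) →ₗ[ℂ] (Fin m → Fin n → ℂ) :=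
  LinearMap.pi fun i => LinearMap.pi fun j =>
    LinearMap.proj (⟨i + (n - 1 - j), by omega⟩ : Fin (m + n - 1))

theorem toeplitz_apply {m n : ℕ} (c : Fin (m + n - 1) → ℂ) (i : Fin m) (j : Fin n) :
    toeplitz m n c i j = c ⟨i + (n - 1 - j), by omega⟩ := rfl

theorem toeplitz_injective {m n : ℕ} (hm : 0 < m) (hn : 0 < n) :
    Function.Injective (toeplitz m n) := by
  intro c d h
  funext s
  have hs := s.2
  -- Truncated subtraction picks the cell of diagonal `s` lying in the first row or first column.
  have h1 := congrFun (congrFun h ⟨s - (n - 1), by omega⟩) ⟨n - 1 - s, by omega⟩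
  rw [toeplitz_apply, toeplitz_apply] at h1
  have : (⟨(s : ℕ) - (n - 1) + (n - 1 - (n - 1 - (s : ℕ))), by omega⟩ : Fin (m + n - 1)) = s :=
    Fin.ext (by simp only; omega)
  rwa [this] at h1

/-- The matrix entries `⟨c j, B (b i)⟩` of an operator `B`. -/
def entries {E F ι κ : Type*} [NormedAddCommGroup E] [InnerProductSpace ℂ E]
    [NormedAddCommGroup F] [InnerProductSpace ℂ F] (b : ι → E) (c : κ → F) :
    (E →L[ℂ] F) →ₗ[ℂ] (ι → κ → ℂ) where
  toFun B i j := inner ℂ (c j) (B (b i))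
  map_add' B C := by ext i j; simp
  map_smul' a B := by ext i j; simp

/-- The bases need not be orthonormal: inner products with a basis already determine a vector. -/
theorem entries_injective {E F ι κ : Type*} [NormedAddCommGroup E] [InnerProductSpace ℂ E]
    [NormedAddCommGroup F] [InnerProductSpace ℂ F] (b : Module.Basis ι ℂ E)
    (c : Module.Basis κ ℂ F) : Function.Injective (entries b c) := by
  intro B C h
  refine ContinuousLinearMap.coe_injective (b.ext fun i => ?_)
  exact InnerProductSpace.ext_inner_left_basis c fun j => congrFun (congrFun h i) j

theorem IsInner.exists_basis {α : ℂ → ℂ} (hα : IsInner α) {m : ℕ} (hm : 0 < m)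
    (hK : Module.finrank ℂ (K α) = m) :
    ∃ (q : C(UnitAddCircle, ℂ)) (b : Module.Basis (Fin m) ℂ (K α)),
      (∀ t, q t ≠ 0) ∧ ∀ i, mulC q (b i) = fourierLp 2 (i : ℤ) := by
  -- Since `finrank` is `0` in infinite dimension, `0 < m` is what gives finiteness.
  have : FiniteDimensional ℂ (K α) := Module.finite_of_finrank_pos (hK ▸ hm)
  subst hK
  exact exists_basis_of_backwardShift_invariant inf_le_left fun f hf => hα.backwardShift_mem_K hf

theorem map_entries_T {α β : ℂ → ℂ} {m n : ℕ} {q r : C(UnitAddCircle, ℂ)}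
    (b : Module.Basis (Fin m) ℂ (K α)) (c : Module.Basis (Fin n) ℂ (K β))
    (hq : ∀ t, q t ≠ 0) (hr : ∀ t, r t ≠ 0)
    (hb : ∀ i, mulC q (b i) = fourierLp 2 (i : ℤ))
    (hc : ∀ j, mulC r (c j) = fourierLp 2 (j : ℤ)) :
    (T α β).map (entries b c) = LinearMap.range (toeplitz m n) := by
  have hbK : ∀ i, b i ∈ KInfty α := fun i => memLp_top_of_mulC_eq hq (hb i)
  have htop : ∀ f, f ∈ KInfty α := fun f => by
    have h : KInfty α = ⊤ := by
      rw [eq_top_iff, ← b.span_eq, Submodule.span_le]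
      rintro _ ⟨i, rfl⟩
      exact hbK i
    exact h ▸ Submodule.mem_top
  have hentry : ∀ (φ : L2) (i : Fin m) (j : Fin n),
      inner ℂ (c j) (A α β φ ⟨b i, htop (b i)⟩)
        = fourierCoeff (fun t => φ t / (q t * conj (r t))) (j - i) := fun φ i j => by
    rw [A_apply, P, Submodule.inner_orthogonalProjectionOnto_eq_of_mem_left]
    exact inner_symbolMul hq hr φ ⟨b i, htop (b i)⟩ (hb i) (hc j)
  apply le_antisymm
  · rintro _ ⟨B, ⟨φ, hφ⟩, rfl⟩
    -- The diagonal `s = i + (n - 1 - j)` carries the index `j - i = n - 1 - s`.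
    refine ⟨fun s => fourierCoeff (fun t => φ t / (q t * conj (r t))) ((n : ℤ) - 1 - s), ?_⟩
    ext i j
    have h : entries b c B i j = _ := (congrArg _ (hφ ⟨b i, htop (b i)⟩)).trans (hentry φ i j)
    rw [h, toeplitz_apply]
    congr 1
    have := j.2
    simp only
    omega
  · rintro _ ⟨d, rfl⟩
    have : FiniteDimensional ℂ (K α) := b.finiteDimensional_of_finite
    -- The trigonometric polynomial `g` has the prescribed diagonals as coefficients; the symbol `φ
    -- = q r̄ g` cancels the denominator `q r̄`.
    set g : L2 := ∑ s : Fin (m + n - 1), d s • (fourierLp 2 ((n : ℤ) - 1 - s) : L2) with hg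
    set w : C(UnitAddCircle, ℂ) := q * star r with hw
    set φ := mulC w g with hφ
    have hφg : (fun t => φ t / (q t * conj (r t))) =ᵐ[circleMeasure] g := by
      filter_upwards [coeFn_mulC w g] with t ht
      rw [ht]
      exact mul_div_cancel_left₀ _
        (mul_ne_zero (hq t) ((map_ne_zero (starRingEnd ℂ)).2 (hr t)))
    let B : K α →L[ℂ] K β :=
      LinearMap.toContinuousLinearMap (A α β φ ∘ₗ LinearMap.id.codRestrict (KInfty α) htop)
    refine ⟨B, ⟨φ, fun f => rfl⟩, ?_⟩
    ext i j
    have h : entries b c B i j = _ := hentry φ i j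
    rw [h, fourierCoeff_congr_ae hφg, ← coef_apply, hg, map_sum, toeplitz_apply,
      Finset.sum_eq_single (⟨i + (n - 1 - j), by omega⟩ : Fin (m + n - 1))]
    · rw [map_smul, coef_fourierLp, if_pos (by have := j.2; simp only; omega), smul_eq_mul, mul_one]
    · intro s _ hs
      rw [map_smul, coef_fourierLp, if_neg, smul_zero]
      intro h
      apply hs
      have := j.2
      exact Fin.ext (by simp only; omega)
    · simp

end

end ATTO

theorem proposition2p1 (α β : ℂ → ℂ) (hα : ATTO.IsInner α) (hβ : ATTO.IsInner β)
    (m n : ℕ) (hm : 0 < m) (hn : 0 < n)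
    (hKα : Module.finrank ℂ (ATTO.K α) = m) (hKβ : Module.finrank ℂ (ATTO.K β) = n) :
    Module.finrank ℂ (ATTO.T α β) = m + n - 1 := by
  obtain ⟨q, b, hq, hb⟩ := hα.exists_basis hm hKα
  obtain ⟨r, c, hr, hc⟩ := hβ.exists_basis hn hKβ
  rw [(Submodule.equivMapOfInjective _ (ATTO.entries_injective b c) _).finrank_eq,
    ATTO.map_entries_T b c hq hr hb hc,
    LinearMap.finrank_range_of_inj (ATTO.toeplitz_injective hm hn), Module.finrank_fin_fun]
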